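/- Theorem 4.12. A standard space is a locally compact separable metrizable space, and quotient maps are surjective. Let $q:Y\to X$ be a quotient map from a standard space $Y$ onto a Hausdorff space $X$. Let $Y_*$ be the set of all non-empty closed subsets of $Y$ that lie in the closure of $\{q^{-1}(x):x\in X\}$ in the Fell topology on the set of all closed subsets of $Y$ (the topology with subbase the families $\{F: F\cap U\neq\emptyset\}$, $U\subseteq Y$ open, and $\{F: F\cap K=\emptyset\}$, $K\subseteq Y$ compact). Give $Y_*$ the induced topology and order it by reverse inclusion: $F_1\le F_2$ if and only if $F_2\subseteq F_1$. Let $q_*:Y_*\to X$ be the (well-defined) map with $q_*(F)=q(y)$ for $y\in F$. Call $x\in X$ a point of compact type if there is a compact set $K\subseteq X$ such that every sequence in $X$ converging to $x$ is eventually in $K$. Suppose that the points of compact type are sequentially dense in $X$, that is, every point of $X$ is the limit of a sequence of points of compact type. Let $V$ be the closure in $Y_*$ of the set of maximal elements of $Y_*$, and suppose that $p=q_*|V:V\to X$ is a quotient map onto $X$. Then $p$ is irreducible, that is, $p$ is surjective and no proper closed subset $C\subsetneq V$ satisfies $p(C)=X$. -/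

import Mathlib

open Set Topology TopologicalSpace

/-- A map `f : A → B` is irreducible if it is surjective and no proper closed subset of `A` is
mapped onto `B`. -/
def IrreducibleMap {A B : Type*} [TopologicalSpace A] (f : A → B) : Prop :=
  Function.Surjective f ∧ ∀ C : Set A, IsClosed C → f '' C = univ → C = univ

/-- A point `x` is of compact type if there is a compact set which eventually contains every
sequence converging to `x`. -/
def IsCompactTypePoint {X : Type*} [TopologicalSpace X] (x : X) : Prop :=
  ∃ K : Set X, IsCompact K ∧
    ∀ u : ℕ → X, Filter.Tendsto u Filter.atTop (𝓝 x) → ∀ᶠ n in Filter.atTop, u n ∈ K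

/-- The Fell topology on the set of closed subsets of `Y`: a subbase is given by the families of
closed sets that meet a given open set, and of closed sets that miss a given compact set. -/
@[reducible]
def fellTopology (Y : Type*) [TopologicalSpace Y] : TopologicalSpace (Closeds Y) :=
  generateFrom
    ({S | ∃ U : Set Y, IsOpen U ∧ S = {F : Closeds Y | ((F : Set Y) ∩ U).Nonempty}} ∪
     {S | ∃ K : Set Y, IsCompact K ∧ S = {F : Closeds Y | Disjoint (F : Set Y) K}})

/-- The closed subsets of `Y` that are fibres of `q`. -/
def fibreSet {X Y : Type*} [TopologicalSpace Y] (q : Y → X) : Set (Closeds Y) :=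
  {F | ∃ y : Y, (F : Set Y) = q ⁻¹' {q y}}

/-- The space `Y_*`: the non-empty closed subsets of `Y` that lie in the closure of the set of
fibres of `q` in the Fell topology. (The empty set plays the role of the point at infinity.) -/
def YStar {X Y : Type*} [TopologicalSpace Y] (q : Y → X) : Type _ :=
  {F : Closeds Y // (F : Set Y).Nonempty ∧ F ∈ @closure _ (fellTopology Y) (fibreSet q)}

namespace YStar

variable {X Y : Type*} [TopologicalSpace Y] {q : Y → X}

/-- `Y_*` carries the topology induced by the Fell topology. -/
instance instTopologicalSpace : TopologicalSpace (YStar q) :=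
  TopologicalSpace.induced Subtype.val (fellTopology Y)

/-- The underlying closed subset of `Y`. -/
def carrier (z : YStar q) : Set Y := (z.1 : Set Y)

theorem carrier_injective : Function.Injective (carrier : YStar q → Set Y) :=
  fun _ _ h => Subtype.ext (SetLike.coe_injective h)

/-- The order of `Y_*` is reverse inclusion. -/
instance instPartialOrder : PartialOrder (YStar q) where
  le z₁ z₂ := z₂.carrier ⊆ z₁.carrier
  le_refl _ := Subset.rfl
  le_trans _ _ _ h₁ h₂ := Subset.trans h₂ h₁
  le_antisymm _ _ h₁ h₂ := carrier_injective (Subset.antisymm h₂ h₁)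

/-- The map `q_* : Y_* → X`, which sends `F` to `q y` for any point `y` of `F`; see
`YStar.map_eq` for the independence of the choice of `y`. -/
noncomputable def map (q : Y → X) (z : YStar q) : X := q z.2.1.some

/-- `q_* F = q y` for every `y ∈ F`. -/
theorem map_eq [TopologicalSpace X] [T2Space X] (hq : Continuous q) (z : YStar q) {y : Y}
    (hy : y ∈ z.carrier) : map q z = q y := by
  by_contra hne
  obtain ⟨U, V, hU, hV, hyU, hyV, hUV⟩ := t2_separation hne
  let _ := fellTopology Y
  have open_hit : ∀ W : Set X, IsOpen W →
      IsOpen {F : Closeds Y | ((F : Set Y) ∩ q ⁻¹' W).Nonempty} := fun W hW =>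
    isOpen_generateFrom_of_mem (Or.inl ⟨q ⁻¹' W, hW.preimage hq, rfl⟩)
  obtain ⟨G, ⟨⟨a, ha, haU⟩, ⟨b, hb, hbV⟩⟩, y', hG⟩ := mem_closure_iff.1 z.2.2 _
    ((open_hit U hU).inter (open_hit V hV)) ⟨⟨_, z.2.1.some_mem, hyU⟩, ⟨y, hy, hyV⟩⟩
  rw [hG] at ha hb
  have hab : q a = q b := (mem_singleton_iff.1 ha).trans (mem_singleton_iff.1 hb).symm
  exact disjoint_left.1 hUV haU (by simpa [hab] using hbV)

end YStar

/-- The closure in `Y_*` of the set of maximal elements of `Y_*`. -/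
def closureMaximal {X Y : Type*} [TopologicalSpace Y] (q : Y → X) : Set (YStar q) :=
  closure {z : YStar q | IsMax z}

namespace YStar

variable {X Y : Type*} [TopologicalSpace Y] {q : Y → X}

/-! Suppose a proper closed `C` in `V` maps onto `X`. By `isCompact_setOf_inter_nonempty`, `C` is a
countable union of compact sets `D n`, and the closed sets `p ⁻¹' (p '' D n)` cover `V`. Since `V`
is locally compact Hausdorff, Baire's theorem and the density of maximal elements give a maximal `z
∉ C` interior to one of them. If `z` is a full fibre, it lies below everything over its image, so by
maximality it equals a point of `C`. Otherwise `exists_isolating_set` gives a set `A` over which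
only `z` can be a new cluster point; as `z ∉ C`, the part of `D n` over `A` is compact, and its
closed image would have to contain `p z ∉ A`. -/

theorem isOpen_setOf_inter_nonempty {U : Set Y} (hU : IsOpen U) :
    IsOpen {z : YStar q | (z.carrier ∩ U).Nonempty} := by
  let _ := fellTopology Y
  exact isOpen_induced (f := (Subtype.val : YStar q → Closeds Y))
    (isOpen_generateFrom_of_mem (Or.inl ⟨U, hU, rfl⟩))

theorem isOpen_setOf_disjoint {K : Set Y} (hK : IsCompact K) :
    IsOpen {z : YStar q | Disjoint z.carrier K} := by
  let _ := fellTopology Y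
  exact isOpen_induced (f := (Subtype.val : YStar q → Closeds Y))
    (isOpen_generateFrom_of_mem (Or.inr ⟨K, hK, rfl⟩))

theorem isClosed_carrier (z : YStar q) : IsClosed z.carrier := z.1.isClosed

/-- Every basic Fell neighbourhood of an element of `Y_*` contains a fibre. -/
theorem exists_fibre (z : YStar q) {U K : Set Y} (hU : IsOpen U) (hK : IsCompact K)
    (hzU : (z.carrier ∩ U).Nonempty) (hzK : Disjoint z.carrier K) :
    ∃ y ∈ U, Disjoint (q ⁻¹' {q y}) K := by
  let _ := fellTopology Y
  obtain ⟨G, ⟨⟨a, ha, haU⟩, hGK⟩, y, hG⟩ := mem_closure_iff.1 z.2.2 _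
    ((isOpen_generateFrom_of_mem (Or.inl ⟨U, hU, rfl⟩)).inter
      (isOpen_generateFrom_of_mem (Or.inr ⟨K, hK, rfl⟩))) ⟨hzU, hzK⟩
  rw [hG] at ha
  refine ⟨a, haU, ?_⟩
  rw [mem_preimage, mem_singleton_iff] at ha
  rw [ha, ← hG]
  exact hGK

theorem carrier_subset [TopologicalSpace X] [T2Space X] (hq : Continuous q) (z : YStar q) :
    z.carrier ⊆ q ⁻¹' {map q z} := fun _ hy => (map_eq hq z hy).symm

theorem continuous_map [TopologicalSpace X] [T2Space X] (hq : Continuous q) :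
    Continuous (map q) := by
  refine continuous_def.2 fun U hU => ?_
  convert isOpen_setOf_inter_nonempty (q := q) (hU.preimage hq) using 1
  ext z
  constructor
  · intro hz
    exact ⟨_, z.2.1.some_mem, hz⟩
  · rintro ⟨y, hy, hyU⟩
    rwa [mem_preimage, map_eq hq z hy]

/-- A point of one set outside the other has a compact neighbourhood `K` missing the other; hitting
`interior K` and missing `K` are disjoint open conditions. -/
instance [T2Space Y] [LocallyCompactSpace Y] : T2Space (YStar q) := by
  have separated : ∀ z w : YStar q, ¬ z.carrier ⊆ w.carrier →
      ∃ S T : Set (YStar q), IsOpen S ∧ IsOpen T ∧ z ∈ S ∧ w ∈ T ∧ Disjoint S T := by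
    intro z w h
    obtain ⟨y, hyz, hyw⟩ := not_subset.1 h
    obtain ⟨K, hK, hyK, hKw⟩ :=
      exists_compact_subset w.isClosed_carrier.isOpen_compl hyw
    refine ⟨_, _, isOpen_setOf_inter_nonempty isOpen_interior, isOpen_setOf_disjoint hK,
      ⟨y, hyz, hyK⟩, disjoint_right.2 fun a ha => hKw ha, ?_⟩
    rw [disjoint_left]
    rintro v ⟨a, hav, haK⟩ hv
    exact disjoint_left.1 hv hav (interior_subset haK)
  refine ⟨fun z w hne => ?_⟩
  by_cases h : z.carrier ⊆ w.carrier
  · obtain ⟨S, T, hS, hT, hw, hz, hST⟩ :=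
      separated w z fun h' => hne (carrier_injective (h.antisymm h'))
    exact ⟨T, S, hT, hS, hz, hw, hST.symm⟩
  · exact separated z w h

/-- The elements of `Y_*` that meet a given compact set form a compact set. -/
theorem isCompact_setOf_inter_nonempty {K : Set Y} (hK : IsCompact K) :
    IsCompact {z : YStar q | (z.carrier ∩ K).Nonempty} := by
  let τ := fellTopology Y
  rw [isCompact_iff_ultrafilter_le_nhds']
  intro f hf
  -- The Fell limit of the ultrafilter.
  let L : Set Y := {y | ∀ U, IsOpen U → y ∈ U → ∀ᶠ z in (f : Filter (YStar q)),
    (z.carrier ∩ U).Nonempty}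
  have missed : ∀ y ∉ L, ∃ U, IsOpen U ∧ y ∈ U ∧ ∀ᶠ z in (f : Filter (YStar q)),
      ¬ (z.carrier ∩ U).Nonempty := by
    intro y hy
    change ¬ ∀ U, _ at hy
    simp only [not_forall] at hy
    obtain ⟨U, hU, hyU, h⟩ := hy
    exact ⟨U, hU, hyU, Ultrafilter.eventually_not.2 h⟩
  have hL : IsClosed L := by
    rw [← isOpen_compl_iff, isOpen_iff_forall_mem_open]
    intro y hy
    obtain ⟨U, hU, hyU, h⟩ := missed y hy
    exact ⟨U, fun a haU haL => ((haL U hU haU).and h).exists.elim fun _ hz => hz.2 hz.1, hU, hyU⟩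
  have misses : ∀ K' : Set Y, IsCompact K' → Disjoint L K' →
      ∀ᶠ z in (f : Filter (YStar q)), Disjoint z.carrier K' := by
    intro K' hK' hd
    let P : Set Y → Prop := fun s => ∀ᶠ z in (f : Filter (YStar q)), Disjoint z.carrier s
    have hmono : ∀ ⦃s t⦄, s ⊆ t → P t → P s := fun s t hst ht =>
      Filter.Eventually.mono ht fun z hz => disjoint_of_subset_right hst hz
    have hunion : ∀ ⦃s t⦄, P s → P t → P (s ∪ t) := fun s t hs ht =>
      (Filter.Eventually.and hs ht).mono fun z hz => disjoint_union_right.2 hz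
    refine hK'.induction_on (p := P) (Filter.Eventually.of_forall fun z => disjoint_empty _)
      hmono hunion ?_
    intro y hy
    obtain ⟨U, hU, hyU, h⟩ := missed y (disjoint_right.1 hd hy)
    exact ⟨U, mem_nhdsWithin_of_mem_nhds (hU.mem_nhds hyU), h.mono fun z hz =>
      disjoint_iff_inter_eq_empty.2 (not_nonempty_iff_eq_empty.1 hz)⟩
  -- Meeting `K` keeps the limit from escaping to the empty set.
  have hLK : (L ∩ K).Nonempty := by
    by_contra h
    obtain ⟨z, hz, hz'⟩ := ((misses K hK (disjoint_iff_inter_eq_empty.2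
      (not_nonempty_iff_eq_empty.1 h))).and hf).exists
    exact hz'.not_disjoint hz
  have lim : Filter.Tendsto (fun z : YStar q => z.1) f (@nhds _ τ ⟨L, hL⟩) := by
    rw [tendsto_nhds_generateFrom_iff]
    rintro S (⟨U, hU, rfl⟩ | ⟨K', hK', rfl⟩) hS
    · obtain ⟨y, hyL, hyU⟩ := hS
      exact hyL U hU hyU
    · exact misses K' hK' hS
  let w : YStar q := ⟨⟨L, hL⟩, hLK.mono inter_subset_left, isClosed_closure.mem_of_tendsto lim
    (Filter.Eventually.of_forall fun z => z.2.2)⟩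
  have hval : IsInducing (fun z : YStar q => z.1) := ⟨rfl⟩
  exact ⟨w, hLK, (hval.nhds_eq_comap w).symm ▸ Filter.tendsto_iff_comap.1 lim⟩

instance [T2Space Y] [LocallyCompactSpace Y] : WeaklyLocallyCompactSpace (YStar q) := by
  refine ⟨fun z => ?_⟩
  obtain ⟨y, hy⟩ := z.2.1
  obtain ⟨K, hK, hyK⟩ := exists_compact_mem_nhds y
  refine ⟨_, isCompact_setOf_inter_nonempty hK, Filter.mem_of_superset
    ((isOpen_setOf_inter_nonempty (q := q) isOpen_interior).mem_nhds
      ⟨y, hy, mem_interior_iff_mem_nhds.2 hyK⟩) ?_⟩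
  rintro v ⟨a, hav, haK⟩
  exact ⟨a, hav, interior_subset haK⟩

/-- A maximal element of `Y_*` that is not a fibre is the only cluster point, outside
`q_*⁻¹ A`, of the elements over a suitable set `A` which accumulates at its image. -/
theorem exists_isolating_set [LocallyCompactSpace Y] [SeparableSpace Y] [MetrizableSpace Y]
    [TopologicalSpace X] [T2Space X] (hq : Continuous q) {z : YStar q} (hz : IsMax z)
    (hfib : z.carrier ≠ q ⁻¹' {map q z}) :
    ∃ A : Set X, map q z ∈ closure A ∧ map q z ∉ A ∧
      ∀ v ∈ closure (map q ⁻¹' A), map q v ∉ A → v = z := by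
  let _ := metrizableSpaceMetric Y
  have : SecondCountableTopology Y := UniformSpace.secondCountable_of_separable Y
  obtain ⟨y', hy', hy'z⟩ := not_subset.1 fun h => hfib ((z.carrier_subset hq).antisymm h)
  obtain ⟨y, hy⟩ := z.2.1
  let E : CompactExhaustion Y := default
  -- Missing the first part forces limits of the fibres into `z`; missing `y'`, a point over `map q
  -- z`, keeps their images different from `map q z`.
  let K : ℕ → Set Y := fun n =>
    (E n \ Metric.thickening (1 / ((n : ℝ) + 1)) z.carrier) ∪ {y'}
  have hK : ∀ n, IsCompact (K n) := fun n =>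
    ((E.isCompact n).diff Metric.isOpen_thickening).union isCompact_singleton
  have hzK : ∀ n, Disjoint z.carrier (K n) := fun n => by
    refine disjoint_union_right.2 ⟨disjoint_left.2 fun b hb hb' => hb'.2 ?_,
      disjoint_singleton_right.2 hy'z⟩
    exact Metric.self_subset_thickening Nat.one_div_pos_of_nat _ hb
  choose a ha haK using fun n : ℕ => z.exists_fibre
    (Metric.isOpen_ball (x := y) (ε := 1 / ((n : ℝ) + 1))) (hK n)
    ⟨y, hy, Metric.mem_ball_self Nat.one_div_pos_of_nat⟩ (hzK n)
  have lim : Filter.Tendsto a Filter.atTop (𝓝 y) :=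
    tendsto_iff_dist_tendsto_zero.2 (squeeze_zero (fun _ => dist_nonneg)
      (fun n => (Metric.mem_ball.1 (ha n)).le) tendsto_one_div_add_atTop_nhds_zero_nat)
  refine ⟨range fun n => q (a n), ?_, ?_, fun v hv hvA => ?_⟩
  · rw [map_eq hq z hy]
    exact mem_closure_of_tendsto ((hq.tendsto y).comp lim)
      (Filter.Eventually.of_forall fun n => mem_range_self n)
  · rintro ⟨n, hn⟩
    have hy'n : y' ∈ q ⁻¹' {q (a n)} := (mem_singleton_iff.1 hy').trans hn.symm
    exact disjoint_left.1 (haK n) hy'n (Or.inr rfl)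
  · suffices h : v.carrier ⊆ z.carrier from le_antisymm (hz h) h
    intro b hb
    by_contra hbz
    obtain ⟨ε, hε, hball⟩ := Metric.isOpen_iff.1 z.isClosed_carrier.isOpen_compl b hbz
    obtain ⟨m, hm⟩ := E.exists_mem b
    obtain ⟨l, hl⟩ := exists_nat_one_div_lt (half_pos hε)
    -- Radius `ε / 2` leaves room for a thickening of width below `ε / 2`; the index `m + 1` puts
    -- `b` in the interior.
    let U := Metric.ball b (ε / 2) ∩ interior (E (m + 1))
    have hUK : ∀ n, max (m + 1) l ≤ n → U ⊆ K n := by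
      rintro n hn c ⟨hcb, hcE⟩
      refine Or.inl ⟨E.subset ((le_max_left _ _).trans hn) (interior_subset hcE), fun hc => ?_⟩
      obtain ⟨d, hd, hcd⟩ := Metric.mem_thickening_iff.1 hc
      refine hball (Metric.mem_ball.2 ?_) hd
      have h1 := Nat.one_div_le_one_div (α := ℝ) ((le_max_right (m + 1) l).trans hn)
      have h2 := dist_triangle d c b
      rw [dist_comm d c] at h2
      have h3 := Metric.mem_ball.1 hcb
      linarith
    -- The early fibres have finitely many images, none equal to `map q v`, so a neighbourhood of
    -- `v` avoids them.
    have hfin : IsClosed ((fun n => q (a n)) '' Iio (max (m + 1) l)) :=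
      ((finite_Iio _).image _).isClosed
    obtain ⟨w, ⟨⟨c, hcw, hcU⟩, hwN⟩, n, hn⟩ := mem_closure_iff.1 hv _
      ((isOpen_setOf_inter_nonempty (Metric.isOpen_ball.inter isOpen_interior)).inter
        (hfin.preimage (continuous_map hq)).isOpen_compl)
      ⟨⟨b, hb, Metric.mem_ball_self (half_pos hε), E.subset_interior_succ m hm⟩,
        fun h => hvA (image_subset_range _ _ h)⟩
    have hNn : max (m + 1) l ≤ n := not_lt.1 fun h => hwN ⟨n, h, hn⟩
    refine disjoint_left.1 (haK n) ?_ (hUK n hNn hcU)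
    exact (mem_singleton_iff.1 (w.carrier_subset hq hcw)).trans hn.symm

end YStar

theorem theorem4p12 {X Y : Type*}
    [TopologicalSpace Y] [LocallyCompactSpace Y] [SeparableSpace Y] [MetrizableSpace Y]
    [TopologicalSpace X] [T2Space X]
    (q : Y → X) (hq : IsQuotientMap q)
    (hE : seqClosure {x : X | IsCompactTypePoint x} = univ)
    (hp : IsQuotientMap ((closureMaximal q).domRestrict (YStar.map q))) :
    IrreducibleMap ((closureMaximal q).domRestrict (YStar.map q)) := by
  refine ⟨hp.surjective, fun C hC hCX => ?_⟩
  have : SecondCountableTopology Y := by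
    let _ := metrizableSpaceMetric Y
    exact UniformSpace.secondCountable_of_separable Y
  set p := (closureMaximal q).domRestrict (YStar.map q)
  have hV : IsClosedEmbedding (Subtype.val : closureMaximal q → YStar q) :=
    isClosed_closure.isClosedEmbedding_subtypeVal
  have : WeaklyLocallyCompactSpace (closureMaximal q) := hV.weaklyLocallyCompactSpace
  by_contra hne
  let E : CompactExhaustion Y := default
  let D : ℕ → Set (closureMaximal q) := fun n =>
    C ∩ Subtype.val ⁻¹' {z : YStar q | (z.carrier ∩ E n).Nonempty}
  have hD : ∀ n, IsCompact (D n) := fun n =>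
    (hV.isCompact_preimage (YStar.isCompact_setOf_inter_nonempty (E.isCompact n))).inter_left hC
  have cover : ⋃ n, p ⁻¹' (p '' D n) = univ := by
    refine eq_univ_of_forall fun v => ?_
    obtain ⟨c, hc, hcv⟩ := hCX.ge (mem_univ (p v))
    obtain ⟨y, hy⟩ := c.1.2.1
    obtain ⟨n, hn⟩ := E.exists_mem y
    exact mem_iUnion.2 ⟨n, c, ⟨hc, y, hy, hn⟩, hcv⟩
  obtain ⟨v, hvC, hv⟩ := (dense_iUnion_interior_of_closed
    (fun n => ((hD n).image hp.continuous).isClosed.preimage hp.continuous)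
    cover).inter_open_nonempty _ hC.isOpen_compl (nonempty_compl.2 hne)
  obtain ⟨n, hn⟩ := mem_iUnion.1 hv
  obtain ⟨O, hO, hOeq⟩ := isOpen_induced_iff.1
    (hC.isOpen_compl.inter (isOpen_interior (s := p ⁻¹' (p '' D n))))
  obtain ⟨z₀, hz₀O, hz₀⟩ := mem_closure_iff.1 v.2 O hO (hOeq.ge ⟨hvC, hn⟩)
  let z : closureMaximal q := ⟨z₀, subset_closure hz₀⟩
  obtain ⟨hzC, hzint⟩ : z ∈ Cᶜ ∩ interior (p ⁻¹' (p '' D n)) := hOeq.le hz₀O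
  by_cases hfib : z₀.carrier = q ⁻¹' {YStar.map q z₀}
  · obtain ⟨c, hc, hcz⟩ := interior_subset hzint
    have hle : z₀ ≤ c.1 := by
      change c.1.carrier ⊆ z₀.carrier
      rw [hfib]
      exact (c.1.carrier_subset hq.continuous).trans
        (preimage_mono (singleton_subset_singleton.2 hcz))
    have hcz' : c = z := Subtype.ext (le_antisymm (hz₀ hle) hle)
    exact hzC (hcz' ▸ hc.1)
  · obtain ⟨A, hzA, hzA', hA⟩ := YStar.exists_isolating_set hq.continuous hz₀ hfib
    have isolated : ∀ w ∈ closure (p ⁻¹' A), w ∉ p ⁻¹' A → w = z := fun w hw hwA =>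
      Subtype.ext (hA _ (map_mem_closure continuous_subtype_val hw fun _ h => h) hwA)
    -- Otherwise `p ⁻¹' A` is closed, hence so is `A`, because `p` is a quotient map.
    have hzcl : z ∈ closure (p ⁻¹' A) := by
      by_contra h
      have hcl : IsClosed (p ⁻¹' A) := isClosed_of_closure_subset fun w hw => by
        by_contra hwA
        exact h (isolated w hw hwA ▸ hw)
      exact hzA' ((hp.isClosed_preimage.1 hcl).closure_subset hzA)
    have hcl : IsClosed (D n ∩ p ⁻¹' A) := isClosed_of_closure_subset fun w hw => by
      have hwD := (hD n).isClosed.closure_subset (closure_mono inter_subset_left hw)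
      refine ⟨hwD, ?_⟩
      by_contra hwA
      exact hzC (isolated w (closure_mono inter_subset_right hw) hwA ▸ hwD.1)
    have himage : IsClosed (p ⁻¹' (p '' (D n ∩ p ⁻¹' A))) :=
      (((hD n).of_isClosed_subset hcl inter_subset_left).image
        hp.continuous).isClosed.preimage hp.continuous
    -- Near `z`, every point over `A` shares its image with a point of `D n`.
    have hz : z ∈ p ⁻¹' (p '' (D n ∩ p ⁻¹' A)) := by
      refine himage.closure_subset (closure_mono ?_
        (isOpen_interior.inter_closure ⟨hzint, hzcl⟩))
      rintro w ⟨hw, hwA⟩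
      obtain ⟨c, hc, hcw⟩ := interior_subset hw
      exact ⟨c, ⟨hc, (congrArg (· ∈ A) hcw).mpr hwA⟩, hcw⟩
    obtain ⟨c, ⟨-, hcA⟩, hcz⟩ := hz
    exact hzA' ((congrArg (· ∈ A) hcz).mp hcA)
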